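/- Let $G=\mathbb R^2\ltimes\mathbb R^+$ be the group with product $(x_1,x_2,a)\cdot(x_1',x_2',a')=(x_1+a x_1',\,x_2+a x_2',\,a a')$, equipped with the right Haar measure $d\rho=a^{-1}\,dx_1\,dx_2\,da$ and the left-invariant hyperbolic distance $d(x,y)=r(y^{-1}x)$, where $r\ge 0$ and $\cosh r(x_1,x_2,a)=\tfrac12\big(a+a^{-1}+a^{-1}(x_1^2+x_2^2)\big)$. Write $L^p=L^p(G,\rho)$ (complex-valued functions). A Calderón–Zygmund set is a set $R=[b_1-L/2,b_1+L/2]\times[b_2-L/2,b_2+L/2]\times[ae^{-r},ae^{r}]$ with $b_1,b_2\in\mathbb R$ and $a,L,r>0$ such that $e^{2}ar\le L<e^{8}ar$ if $r<1$, and $ae^{2r}\le L<ae^{8r}$ if $r\ge 1$. An atom is a function $u\in L^1$ supported in a Calderón–Zygmund set $R$ with $\|u\|_\infty\le\rho(R)^{-1}$ and $\int u\,d\rho=0$. The Hardy space $H^1$ is the space of all $f\in L^1$ of the form $f=\sum_j\lambda_ju_j$ (convergence in $L^1$) with atoms $u_j$ and complex numbers $\lambda_j$ such that $\sum_j|\lambda_j|<\infty$;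 $\|f\|_{H^1}$ is the infimum of $\sum_j|\lambda_j|$ over all such decompositions. Proposition. Let $T$ be a bounded linear operator on $L^2$ such that $T=\sum_{j\in\mathbb Z}T_j$, where (i) the $T_j$ are bounded operators on $L^2$ and the series converges in the strong operator topology of $L^2$ (it is enough that $\sum_{|j|\le N}T_jf\to Tf$ in $L^2$ for every $f\in L^2$); (ii) every $T_j$ is an integral operator with a measurable integral kernel, also denoted $T_j$: for every $f\in L^1\cap L^2$, $T_jf(x)=\int_G T_j(x,y)f(y)\,d\rho(y)$ for almost every $x$, with absolute convergence; (iii) there exist positive constants $\alpha,A,\varepsilon$ and $c>1$ such that for all $j\in\mathbb Z$ $$\int_G|T_j(x,y)|\,\big(1+c^jd(x,y)\big)^{\varepsilon}\,d\rho(x)\le A\qquad\forall y\in G,$$ $$\int_G|T_j(x,y)-T_j(x,z)|\,d\rho(x)\le A\,\big(c^jd(y,z)\big)^{\alpha}\qquad\forall y,z\in G.$$ Then $T$ is bounded from $H^1$ to $L^1$: there is exactly one linear operator $S:H^1\to L^1$ that coincides with $T$ on $H^1\cap L^2$ and satisfies $\|Sf\|_1\le C\|f\|_{H^1}$ for all $f\in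 H^1$, with a constant $C$ independent of $f$. -/

import Mathlib

open MeasureTheory Filter Topology
open scoped ENNReal NNReal

noncomputable section

namespace SolvGroup

/-- The underlying set `ℝ² × ℝ⁺` of the group `ℝ² ⋊ ℝ⁺`; points are `(x₁, x₂, a)`, `a > 0`. -/
def G : Type := ℝ × ℝ × Set.Ioi (0 : ℝ)

namespace G

/-- First coordinate `x₁`. -/
def x₁ (p : G) : ℝ := p.1

/-- Second coordinate `x₂`. -/
def x₂ (p : G) : ℝ := p.2.1

/-- Third coordinate `a`. -/
def ht (p : G) : ℝ := p.2.2.1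

/-- The point `(x, y, a)`. -/
def mk (x y a : ℝ) (ha : 0 < a) : G := (x, y, ⟨a, ha⟩)

theorem ht_pos (p : G) : 0 < p.ht := p.2.2.2

theorem ext' {p q : G} (h₁ : p.x₁ = q.x₁) (h₂ : p.x₂ = q.x₂) (h₃ : p.ht = q.ht) : p = q :=
  Prod.ext h₁ (Prod.ext h₂ (Subtype.ext h₃))

/-- `(x₁,x₂,a)·(x₁',x₂',a') = (x₁ + a x₁', x₂ + a x₂', a a')`. -/
instance : Mul G :=
  ⟨fun p q => mk (p.x₁ + p.ht * q.x₁) (p.x₂ + p.ht * q.x₂) (p.ht * q.ht)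
    (mul_pos p.ht_pos q.ht_pos)⟩

instance : One G := ⟨mk 0 0 1 one_pos⟩

instance : Inv G :=
  ⟨fun p => mk (-(p.ht⁻¹ * p.x₁)) (-(p.ht⁻¹ * p.x₂)) p.ht⁻¹ (inv_pos.2 p.ht_pos)⟩

theorem mul_x₁ (p q : G) : (p * q).x₁ = p.x₁ + p.ht * q.x₁ := rfl
theorem mul_x₂ (p q : G) : (p * q).x₂ = p.x₂ + p.ht * q.x₂ := rfl
theorem mul_ht (p q : G) : (p * q).ht = p.ht * q.ht := rfl
theorem one_x₁ : (1 : G).x₁ = 0 := rfl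
theorem one_x₂ : (1 : G).x₂ = 0 := rfl
theorem one_ht : (1 : G).ht = 1 := rfl
theorem inv_x₁ (p : G) : (p⁻¹).x₁ = -(p.ht⁻¹ * p.x₁) := rfl
theorem inv_x₂ (p : G) : (p⁻¹).x₂ = -(p.ht⁻¹ * p.x₂) := rfl
theorem inv_ht (p : G) : (p⁻¹).ht = p.ht⁻¹ := rfl

instance : Group G :=
  Group.ofLeftAxioms
    (fun p q s => ext' (by simp only [mul_x₁, mul_ht]; ring)
      (by simp only [mul_x₂, mul_ht]; ring) (by simp only [mul_ht]; ring))
    (fun p => ext' (by simp only [mul_x₁, one_x₁, one_ht]; ring)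
      (by simp only [mul_x₂, one_x₂, one_ht]; ring) (by simp only [mul_ht, one_ht]; ring))
    (fun p => ext' (by simp only [mul_x₁, inv_x₁, inv_ht, one_x₁]; ring)
      (by simp only [mul_x₂, inv_x₂, inv_ht, one_x₂]; ring)
      (by simp only [mul_ht, inv_ht, one_ht]; exact inv_mul_cancel₀ p.ht_pos.ne'))

/-- The Borel (product) σ-algebra of `ℝ² × ℝ⁺`. -/
instance : MeasurableSpace G := inferInstanceAs (MeasurableSpace (ℝ × ℝ × Set.Ioi (0 : ℝ)))

end G

/-- The right Haar measure `dρ = a⁻¹ dx₁ dx₂ da`. -/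
def rho : Measure G :=
  Measure.withDensity
    ((volume : Measure ℝ).prod ((volume : Measure ℝ).prod
      (Measure.comap (Subtype.val : Set.Ioi (0 : ℝ) → ℝ) volume)) :
        Measure (ℝ × ℝ × Set.Ioi (0 : ℝ)))
    fun p => ENNReal.ofReal (G.ht p)⁻¹

/-- The distance `r(x)` from `x` to the identity:
`cosh r(x₁,x₂,a) = (a + a⁻¹ + a⁻¹ (x₁² + x₂²)) / 2`, `r ≥ 0`. -/
def distOne (p : G) : ℝ :=
  Real.arcosh ((p.ht + p.ht⁻¹ + p.ht⁻¹ * (p.x₁ ^ 2 + p.x₂ ^ 2)) / 2)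

/-- The left-invariant hyperbolic distance `d(x, y) = r(y⁻¹ x)`. -/
def hdist (x y : G) : ℝ := distOne (y⁻¹ * x)

/-- The parallelepiped
`[b₁ - L/2, b₁ + L/2] × [b₂ - L/2, b₂ + L/2] × [a e^{-r}, a e^r]`. -/
def box (b₁ b₂ a L r : ℝ) : Set G :=
  {p | p.x₁ ∈ Set.Icc (b₁ - L / 2) (b₁ + L / 2) ∧
    p.x₂ ∈ Set.Icc (b₂ - L / 2) (b₂ + L / 2) ∧
    p.ht ∈ Set.Icc (a * Real.exp (-r)) (a * Real.exp r)}

/-- Calderón–Zygmund sets. -/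
def IsCZSet (R : Set G) : Prop :=
  ∃ b₁ b₂ a L r : ℝ, 0 < a ∧ 0 < L ∧ 0 < r ∧ R = box b₁ b₂ a L r ∧
    (r < 1 → Real.exp 2 * a * r ≤ L ∧ L < Real.exp 8 * a * r) ∧
    (1 ≤ r → a * Real.exp (2 * r) ≤ L ∧ L < a * Real.exp (8 * r))

/-- Atoms: `L¹` functions `u` supported in a Calderón–Zygmund set `R`, with
`‖u‖_∞ ≤ ρ(R)⁻¹` and `∫ u dρ = 0`. -/
def IsAtom (u : Lp ℂ 1 rho) : Prop :=
  ∃ R : Set G, IsCZSet R ∧ (∀ᵐ x ∂rho, x ∉ R → u x = 0) ∧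
    eLpNorm u ∞ rho ≤ (rho R)⁻¹ ∧ ∫ x, u x ∂rho = 0

/-- `f = ∑ⱼ λⱼ uⱼ` in `L¹`, with atoms `uⱼ` and `∑ⱼ |λⱼ| < ∞`. -/
def IsAtomicDecomposition (f : Lp ℂ 1 rho) (lam : ℕ → ℂ) (u : ℕ → Lp ℂ 1 rho) : Prop :=
  (∀ j, IsAtom (u j)) ∧ (Summable fun j => ‖lam j‖) ∧ HasSum (fun j => lam j • u j) f

theorem exists_isCZSet : ∃ R, IsCZSet R :=
  ⟨_, 0, 0, 1, Real.exp 2, 1, one_pos, Real.exp_pos _, one_pos, rfl,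
    fun h => absurd h (lt_irrefl _), fun _ => by
      constructor
      · simp
      · rw [one_mul]; exact Real.exp_lt_exp.2 (by norm_num)⟩

theorem isAtom_zero : IsAtom 0 := by
  obtain ⟨R, hR⟩ := exists_isCZSet
  have h : ((0 : Lp ℂ 1 rho) : G → ℂ) =ᵐ[rho] 0 := Lp.coeFn_zero _ _ _
  refine ⟨R, hR, h.mono fun x hx _ => hx, ?_, ?_⟩
  · rw [eLpNorm_congr_ae h]; simp
  · rw [integral_congr_ae h]; simp

/-- The atomic Hardy space `H¹`, as a linear subspace of `L¹(ρ)`. -/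
def hardy : Submodule ℂ (Lp ℂ 1 rho) where
  carrier := {f | ∃ lam u, IsAtomicDecomposition f lam u}
  zero_mem' := ⟨0, 0, fun _ => isAtom_zero, by simp, by simp⟩
  smul_mem' := by
    rintro c f ⟨lam, u, h₁, h₂, h₃⟩
    refine ⟨fun j => c * lam j, u, h₁, ?_, ?_⟩
    · simpa [norm_mul] using h₂.mul_left ‖c‖
    · simpa [mul_smul] using h₃.const_smul c
  add_mem' := by
    rintro f g ⟨lam, u, h₁, h₂, h₃⟩ ⟨mu, v, k₁, k₂, k₃⟩
    let e : ℕ ≃ ℕ ⊕ ℕ := Equiv.natSumNatEquivNat.symm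
    refine ⟨fun n => Sum.elim lam mu (e n), fun n => Sum.elim u v (e n), ?_, ?_, ?_⟩
    · intro n
      rcases h : e n with i | i
      · simpa [h] using h₁ i
      · simpa [h] using k₁ i
    · exact (e.summable_iff (f := fun s => ‖Sum.elim lam mu s‖)).2
        ((show HasSum (fun s => ‖Sum.elim lam mu s‖) _ from
          HasSum.sum (f := fun s => ‖Sum.elim lam mu s‖) h₂.hasSum k₂.hasSum).summable)
    · exact (e.hasSum_iff (f := fun s => Sum.elim lam mu s • Sum.elim u v s)).2
        (HasSum.sum (f := fun s => Sum.elim lam mu s • Sum.elim u v s) h₃ k₃)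

/-- `‖f‖_{H¹}`: the infimum of `∑ⱼ |λⱼ|` over all atomic decompositions of `f`. -/
def hardyNorm (f : Lp ℂ 1 rho) : ℝ≥0∞ :=
  ⨅ (lam : ℕ → ℂ) (u : ℕ → Lp ℂ 1 rho) (_ : IsAtomicDecomposition f lam u), ∑' j, ‖lam j‖ₑ

/-- The bounded operator `S` on `L²(ρ)` is an integral operator with integral kernel `K`:
`K` is measurable, and `S f (x) = ∫ K(x,y) f(y) dρ(y)` for almost every `x`, the integral being
absolutely convergent, for every `f ∈ L¹ ∩ L²`. -/
def HasIntegralKernel (S : Lp ℂ 2 rho →L[ℂ] Lp ℂ 2 rho) (K : G → G → ℂ) : Prop :=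
  AEStronglyMeasurable (Function.uncurry K) (rho.prod rho) ∧
  (∀ y, AEStronglyMeasurable (fun x => K x y) rho) ∧
  ∀ f : Lp ℂ 2 rho, Integrable f rho → ∀ᵐ x ∂rho,
    Integrable (fun y => K x y * f y) rho ∧ S f x = ∫ y, K x y * f y ∂rho

/-- `T`, a bounded operator on `L²(ρ)`, is bounded from `H¹` to `L¹`: there is exactly one linear
operator `H¹ → L¹` with `‖S f‖₁ ≤ C ‖f‖_{H¹}` that coincides with `T` on `H¹ ∩ L²`. -/
def BoundedHardyToL1 (T : Lp ℂ 2 rho →L[ℂ] Lp ℂ 2 rho) : Prop :=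
  ∃! S : hardy →ₗ[ℂ] Lp ℂ 1 rho,
    (∃ C : ℝ≥0, ∀ f : hardy, ‖S f‖ₑ ≤ C * hardyNorm f) ∧
    ∀ (f : hardy) (g : Lp ℂ 2 rho), (f : Lp ℂ 1 rho) =ᵐ[rho] g → S f =ᵐ[rho] T g

end SolvGroup

end

/-!
Write `Q N` for the sum of the `Tj j` over `|j| ≤ N`. By Schur's test and the size condition, the
kernels also define bounded operators on `L¹`, so that `Q N` acts on all of `L¹`, although with a
norm that may grow with `N`. The operator on the Hardy space is the limit of `Q N f` in `L¹`, which
makes it well defined and linear without any reference to an atomic decomposition, and without a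
weak type estimate for `T`.

The limit exists because, on atoms, the `Q N` are uniformly bounded and convergent in `L¹`
(`exists_atom_bound`). For an atom `u` supported in a Calderón–Zygmund set `R` with parameters
`a, L, r`, the points at distance less than `r` from `R` lie in the box `R'` with parameters
`a, 3L, 2r`, whose measure is `18 ρ(R)`.

* On `R'` the Cauchy–Schwarz inequality reduces everything to `L²`, where `Q N u` converges, with
  norms bounded uniformly in `N` by the Banach–Steinhaus theorem.
* Outside `R'` the series `∑ Tj u` converges absolutely in `L¹`: the size condition bounds the term
  with index `j` by `A (c ^ j r) ^ (-ε)`, and the smoothness condition, with the vanishing mean of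
  `u` and the fact that `R` has diameter at most a multiple of `r`, bounds it by a multiple of
  `(c ^ j r) ^ α`. The sum over `j` of the smaller of the two is bounded independently of `r`.

Summing over an atomic decomposition of `f` with dominated convergence gives the convergence of
`Q N f` and the bound for the limit (`exists_tendsto_of_atoms`). If `f` is also in `L²`, then
`Q N f` tends to `T f` in `L²`, and the two limits agree because both imply convergence in measure.
Uniqueness holds because atoms belong to `L²` and finite combinations of atoms are dense for the
Hardy norm (`eq_zero_of_forall_atom`).
-/

namespace SolvGroup

/-! ### Geometry of Calderón–Zygmund sets -/

theorem cosh_distOne (p : G) :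
    Real.cosh (distOne p) = (p.ht + p.ht⁻¹ + p.ht⁻¹ * (p.x₁ ^ 2 + p.x₂ ^ 2)) / 2 := by
  refine Real.cosh_arcosh ?_
  have hp := p.ht_pos
  have h1 : 0 ≤ p.ht⁻¹ * (p.x₁ ^ 2 + p.x₂ ^ 2) := by positivity
  have h2 : 2 ≤ p.ht + p.ht⁻¹ := by
    have : p.ht + p.ht⁻¹ - 2 = p.ht⁻¹ * (p.ht - 1) ^ 2 := by field_simp; ring
    have : 0 ≤ p.ht⁻¹ * (p.ht - 1) ^ 2 := by positivity
    linarith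
  linarith

theorem distOne_nonneg (p : G) : 0 ≤ distOne p := by
  refine Real.arcosh_nonneg ?_
  rw [← cosh_distOne]; exact Real.one_le_cosh _

theorem hdist_nonneg (x y : G) : 0 ≤ hdist x y := distOne_nonneg _

/-- The distance in coordinates, in the form `cosh d = (x² + y² + |x' - y'|²) / (2 x y)` with
`x, y` the heights and `x', y'` the horizontal parts. -/
theorem two_mul_cosh_hdist (x y : G) :
    2 * x.ht * y.ht * Real.cosh (hdist x y) =
      x.ht ^ 2 + y.ht ^ 2 + (x.x₁ - y.x₁) ^ 2 + (x.x₂ - y.x₂) ^ 2 := by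
  have hx := x.ht_pos
  have hy := y.ht_pos
  rw [hdist, cosh_distOne]
  simp only [G.mul_ht, G.mul_x₁, G.mul_x₂, G.inv_ht, G.inv_x₁, G.inv_x₂]
  field_simp
  ring

/-- A ball of radius `r` about `y` has horizontal radius at most `y.ht * sinh r`. -/
theorem sq_add_sq_le_of_hdist_lt {x y : G} {r : ℝ} (h : hdist x y < r) :
    (x.x₁ - y.x₁) ^ 2 + (x.x₂ - y.x₂) ^ 2 ≤ (y.ht * Real.sinh r) ^ 2 := by
  have hc : Real.cosh (hdist x y) ≤ Real.cosh r := by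
    rw [Real.cosh_le_cosh, abs_of_nonneg (hdist_nonneg x y)]
    exact h.le.trans (le_abs_self r)
  have h1 := two_mul_cosh_hdist x y
  have h2 : 2 * x.ht * y.ht * Real.cosh (hdist x y) ≤ 2 * x.ht * y.ht * Real.cosh r := by
    have := x.ht_pos
    have := y.ht_pos
    gcongr
  have h3 := Real.cosh_sq r
  have h4 : y.ht ^ 2 * Real.cosh r ^ 2 = y.ht ^ 2 * (Real.sinh r ^ 2 + 1) := by rw [h3]
  -- in terms of the heights, `2 x y cosh r - x² - y²` is at most `y² sinh² r`, its value at
  -- `x = y cosh r`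
  nlinarith [sq_nonneg (x.ht - y.ht * Real.cosh r)]

theorem abs_log_ht_sub_le_hdist (x y : G) :
    |Real.log x.ht - Real.log y.ht| ≤ hdist x y := by
  have hx := x.ht_pos
  have hy := y.ht_pos
  rw [← abs_of_nonneg (hdist_nonneg x y), ← Real.cosh_le_cosh]
  have h1 := two_mul_cosh_hdist x y
  have h2 : 2 * x.ht * y.ht * Real.cosh (Real.log x.ht - Real.log y.ht) =
      x.ht ^ 2 + y.ht ^ 2 := by
    rw [← Real.log_div hx.ne' hy.ne', Real.cosh_log (by positivity)]
    field_simp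
  have h3 : 0 < 2 * x.ht * y.ht := by positivity
  refine le_of_mul_le_mul_left ?_ h3
  nlinarith [sq_nonneg (x.x₁ - y.x₁), sq_nonneg (x.x₂ - y.x₂)]

theorem mem_box_iff_log {b₁ b₂ a L r : ℝ} (ha : 0 < a) {p : G} :
    p ∈ box b₁ b₂ a L r ↔ |p.x₁ - b₁| ≤ L / 2 ∧ |p.x₂ - b₂| ≤ L / 2 ∧
      |Real.log p.ht - Real.log a| ≤ r := by
  have hp := p.ht_pos
  have h1 : a * Real.exp (-r) ≤ p.ht ↔ Real.log a - r ≤ Real.log p.ht := by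
    rw [Real.le_log_iff_exp_le hp, sub_eq_add_neg, Real.exp_add, Real.exp_log ha]
  have h2 : p.ht ≤ a * Real.exp r ↔ Real.log p.ht ≤ Real.log a + r := by
    rw [Real.log_le_iff_le_exp hp, Real.exp_add, Real.exp_log ha]
  simp only [box, Set.mem_ofPred_eq, Set.mem_Icc, h1, h2, abs_le]
  constructor <;> rintro ⟨⟨_, _⟩, ⟨_, _⟩, _, _⟩ <;> refine ⟨⟨?_, ?_⟩, ⟨?_, ?_⟩, ?_, ?_⟩ <;> linarith

/-- The size constraints relating the three parameters of a Calderón–Zygmund set. -/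
structure IsAdmissible (a L r : ℝ) : Prop where
  a_pos : 0 < a
  L_pos : 0 < L
  r_pos : 0 < r
  small : r < 1 → Real.exp 2 * a * r ≤ L ∧ L < Real.exp 8 * a * r
  large : 1 ≤ r → a * Real.exp (2 * r) ≤ L ∧ L < a * Real.exp (8 * r)

theorem sinh_le_mul_exp (r : ℝ) : Real.sinh r ≤ r * Real.exp r := by
  -- `2 sinh r = e^r (1 - e^(-2r))` and `1 - e^(-2r) ≤ 2r`
  have h1 := Real.add_one_le_exp (-(2 * r))
  have h2 : Real.exp (-r) = Real.exp r * Real.exp (-(2 * r)) := by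
    rw [← Real.exp_add]; ring_nf
  rw [Real.sinh_eq, h2]
  nlinarith [Real.exp_pos r]

/-- The lower bounds for `L` say that `L` dominates the horizontal radius of a ball of radius `r`
about a point of maximal height `a * exp r`. -/
theorem IsAdmissible.exp_mul_sinh_le {a L r : ℝ} (h : IsAdmissible a L r) :
    a * Real.exp r * Real.sinh r ≤ L := by
  have ha := h.a_pos
  have hr := h.r_pos
  have h2 : Real.exp (2 * r) = Real.exp r * Real.exp r := by rw [← Real.exp_add]; ring_nf
  rcases lt_or_ge r 1 with hr1 | hr1
  · refine le_trans ?_ (h.small hr1).1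
    have h3 : Real.exp (2 * r) ≤ Real.exp 2 := Real.exp_le_exp.2 (by linarith)
    calc a * Real.exp r * Real.sinh r ≤ a * Real.exp r * (r * Real.exp r) := by
          gcongr; exact sinh_le_mul_exp r
      _ = Real.exp (2 * r) * a * r := by rw [h2]; ring
      _ ≤ _ := by gcongr
  · refine le_trans ?_ (h.large hr1).1
    rw [h2, ← mul_assoc]
    gcongr
    rw [Real.sinh_eq]
    linarith [Real.exp_pos r, Real.exp_pos (-r)]

/-- The `r`-neighbourhood of a Calderón–Zygmund set lies in a box of comparable measure. -/
theorem IsAdmissible.mem_box_of_hdist_lt {b₁ b₂ a L r : ℝ} (h : IsAdmissible a L r) {x y : G}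
    (hy : y ∈ box b₁ b₂ a L r) (hxy : hdist x y < r) : x ∈ box b₁ b₂ a (3 * L) (2 * r) := by
  have hya : y.ht ≤ a * Real.exp r := hy.2.2.2
  rw [mem_box_iff_log h.a_pos] at hy ⊢
  obtain ⟨h1, h2, h3⟩ := hy
  have hL : y.ht * Real.sinh r ≤ L := by
    refine le_trans ?_ h.exp_mul_sinh_le
    have := Real.sinh_nonneg_iff.2 h.r_pos.le
    gcongr
  have hs := sq_add_sq_le_of_hdist_lt hxy
  have h0 : 0 ≤ y.ht * Real.sinh r :=
    mul_nonneg y.ht_pos.le (Real.sinh_nonneg_iff.2 h.r_pos.le)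
  have e1 : |x.x₁ - y.x₁| ≤ L :=
    (abs_le_of_sq_le_sq (by nlinarith [sq_nonneg (x.x₂ - y.x₂)]) h0).trans hL
  have e2 : |x.x₂ - y.x₂| ≤ L :=
    (abs_le_of_sq_le_sq (by nlinarith [sq_nonneg (x.x₁ - y.x₁)]) h0).trans hL
  have e3 := (abs_log_ht_sub_le_hdist x y).trans hxy.le
  refine ⟨?_, ?_, ?_⟩
  · linarith [abs_sub_le x.x₁ y.x₁ b₁]
  · linarith [abs_sub_le x.x₂ y.x₂ b₂]
  · linarith [abs_sub_le (Real.log x.ht) (Real.log y.ht) (Real.log a)]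

theorem one_add_half_sq_le_cosh {x : ℝ} (hx : 0 ≤ x) : 1 + x ^ 2 / 2 ≤ Real.cosh x := by
  have h1 : x / 2 ≤ Real.sinh (x / 2) := Real.self_le_sinh_iff.2 (by positivity)
  have h2 := Real.cosh_two_mul (x / 2)
  rw [mul_div_cancel₀ x two_ne_zero, Real.cosh_sq] at h2
  nlinarith

/-- The upper bounds for `L`, in the form needed for the diameter; the left side bounds the `cosh`
of the distance of a point of the set to the centre. -/
theorem IsAdmissible.cosh_add_le {a L r : ℝ} (h : IsAdmissible a L r) :
    Real.cosh r + L ^ 2 * Real.exp r / (4 * a ^ 2) ≤ Real.cosh (Real.exp 10 * r) := by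
  have ha := h.a_pos
  have hr := h.r_pos
  have hL := h.L_pos
  have h10 : (11 : ℝ) ≤ Real.exp 10 := by have := Real.add_one_le_exp (10 : ℝ); linarith
  rcases lt_or_ge r 1 with hr1 | hr1
  · -- both sides are compared with `1` plus a multiple of `r ^ 2`
    have hq : L ^ 2 ≤ (Real.exp 8 * a * r) ^ 2 := by gcongr; exact (h.small hr1).2.le
    have e1 : Real.exp r ≤ Real.exp 1 := Real.exp_le_exp.2 hr1.le
    have e2 : L ^ 2 * Real.exp r / (4 * a ^ 2) ≤ Real.exp 17 * r ^ 2 / 4 := by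
      rw [div_le_div_iff₀ (by positivity) (by norm_num)]
      have : Real.exp 17 = Real.exp 8 ^ 2 * Real.exp 1 := by
        rw [← Real.exp_nat_mul, ← Real.exp_add]; norm_num
      calc L ^ 2 * Real.exp r * 4 ≤ (Real.exp 8 * a * r) ^ 2 * Real.exp 1 * 4 := by gcongr
        _ = _ := by rw [this]; ring
    have e3 : Real.cosh r ≤ 1 + r ^ 2 := by
      have h1 := Real.cosh_le_exp_half_sq r
      have h2 : Real.exp (r ^ 2 / 2) ≤ 1 / (1 - r ^ 2 / 2) :=
        Real.exp_bound_div_one_sub_of_interval (by positivity) (by nlinarith)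
      have h3 : 1 / (1 - r ^ 2 / 2) ≤ 1 + r ^ 2 := by
        rw [div_le_iff₀ (by nlinarith)]
        nlinarith [mul_nonneg (sq_nonneg r) (show 0 ≤ 1 - r ^ 2 by nlinarith)]
      linarith
    have e4 : 1 + (Real.exp 10 * r) ^ 2 / 2 ≤ Real.cosh (Real.exp 10 * r) :=
      one_add_half_sq_le_cosh (by positivity)
    have e5 : Real.exp 17 ≤ Real.exp 10 ^ 2 := by
      rw [← Real.exp_nat_mul]; exact Real.exp_le_exp.2 (by norm_num)
    have e6 : Real.exp 17 * r ^ 2 / 4 ≤ Real.exp 10 ^ 2 * r ^ 2 / 4 := by gcongr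
    have e7 : r ^ 2 * 121 ≤ Real.exp 10 ^ 2 * r ^ 2 := by
      nlinarith [sq_nonneg r, mul_self_nonneg (Real.exp 10 - 11)]
    nlinarith [sq_nonneg r]
  · -- the left side is bounded by a multiple of `exp (17 r)`, the right side below by `exp (22 r) / 2`
    have hq : L ^ 2 ≤ (a * Real.exp (8 * r)) ^ 2 := by gcongr; exact (h.large hr1).2.le
    have e2 : L ^ 2 * Real.exp r / (4 * a ^ 2) ≤ Real.exp (17 * r) / 4 := by
      rw [div_le_div_iff₀ (by positivity) (by norm_num)]
      have : Real.exp (17 * r) = Real.exp (8 * r) ^ 2 * Real.exp r := by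
        rw [← Real.exp_nat_mul, ← Real.exp_add]; ring_nf
      calc L ^ 2 * Real.exp r * 4 ≤ (a * Real.exp (8 * r)) ^ 2 * Real.exp r * 4 := by gcongr
        _ = _ := by rw [this]; ring
    have e3 : Real.cosh r ≤ Real.exp (17 * r) := by
      rw [Real.cosh_eq]
      have h1 : Real.exp r ≤ Real.exp (17 * r) := Real.exp_le_exp.2 (by linarith)
      have h2 : Real.exp (-r) ≤ Real.exp (17 * r) := Real.exp_le_exp.2 (by linarith)
      linarith
    have h22 : (22 : ℝ) ≤ Real.exp 10 := by
      have := Real.quadratic_le_exp_of_nonneg (x := 10) (by norm_num); linarith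
    have e4 : Real.exp (22 * r) / 2 ≤ Real.cosh (Real.exp 10 * r) := by
      rw [Real.cosh_eq]
      have h1 : Real.exp (22 * r) ≤ Real.exp (Real.exp 10 * r) := Real.exp_le_exp.2 (by gcongr)
      linarith [Real.exp_pos (-(Real.exp 10 * r))]
    have e5 : Real.exp (22 * r) = Real.exp (5 * r) * Real.exp (17 * r) := by
      rw [← Real.exp_add]; ring_nf
    have e6 : 6 ≤ Real.exp (5 * r) := by linarith [Real.add_one_le_exp (5 * r)]
    nlinarith [Real.exp_pos (17 * r)]

/-- Every point of a Calderón–Zygmund set is within a multiple of `r` of the centre. -/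
theorem IsAdmissible.hdist_center_le {b₁ b₂ a L r : ℝ} (h : IsAdmissible a L r) {y : G}
    (hy : y ∈ box b₁ b₂ a L r) :
    hdist y (G.mk b₁ b₂ a h.a_pos) ≤ Real.exp 10 * r := by
  have ha := h.a_pos
  have hr := h.r_pos
  have hL := h.L_pos
  have hyp := y.ht_pos
  set z : G := G.mk b₁ b₂ a ha
  rw [← abs_of_nonneg (hdist_nonneg y z), ← abs_of_nonneg (by positivity : 0 ≤ Real.exp 10 * r),
    ← Real.cosh_le_cosh]
  refine le_trans ?_ h.cosh_add_le
  have hlow : a * Real.exp (-r) ≤ y.ht := hy.2.2.1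
  obtain ⟨h1, h2, h3⟩ := (mem_box_iff_log ha).1 hy
  have e1 : Real.cosh (Real.log y.ht - Real.log a) ≤ Real.cosh r :=
    Real.cosh_le_cosh.2 (h3.trans (le_abs_self r))
  have e2 : 2 * y.ht * a * Real.cosh (Real.log y.ht - Real.log a) = y.ht ^ 2 + a ^ 2 := by
    rw [← Real.log_div hyp.ne' ha.ne', Real.cosh_log (by positivity)]
    field_simp
  have e3 := two_mul_cosh_hdist y z
  have z1 : z.x₁ = b₁ := rfl
  have z2 : z.x₂ = b₂ := rfl
  have z3 : z.ht = a := rfl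
  rw [z1, z2, z3] at e3
  have s1 : (y.x₁ - b₁) ^ 2 ≤ (L / 2) ^ 2 :=
    sq_le_sq' (by linarith [(abs_le.1 h1).1]) (abs_le.1 h1).2
  have s2 : (y.x₂ - b₂) ^ 2 ≤ (L / 2) ^ 2 :=
    sq_le_sq' (by linarith [(abs_le.1 h2).1]) (abs_le.1 h2).2
  have e4 : a ≤ y.ht * Real.exp r := by
    calc a = a * Real.exp (-r) * Real.exp r := by
          rw [mul_assoc, ← Real.exp_add]; simp
      _ ≤ _ := by gcongr
  have e5 : L ^ 2 / 2 ≤ 2 * y.ht * a * (L ^ 2 * Real.exp r / (4 * a ^ 2)) := by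
    have : 2 * y.ht * a * (L ^ 2 * Real.exp r / (4 * a ^ 2)) =
        L ^ 2 / 2 * (y.ht * Real.exp r / a) := by field_simp; ring
    rw [this]
    exact le_mul_of_one_le_right (by positivity) ((one_le_div ha).2 e4)
  have hpos : 0 < 2 * y.ht * a := by positivity
  refine le_of_mul_le_mul_left ?_ hpos
  rw [e3, mul_add]
  have e6 := mul_le_mul_of_nonneg_left e1 hpos.le
  nlinarith

/-! ### The measure of a box -/

theorem sigmaFinite_comap_Ioi :
    SigmaFinite (Measure.comap (Subtype.val : Set.Ioi (0 : ℝ) → ℝ) volume) := by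
  have : IsFiniteMeasureOnCompacts
      (Measure.comap (Subtype.val : Set.Ioi (0 : ℝ) → ℝ) volume) :=
    .comap' _ continuous_subtype_val (MeasurableEmbedding.subtype_coe measurableSet_Ioi)
  have : LocallyCompactSpace (Set.Ioi (0 : ℝ)) := isOpen_Ioi.locallyCompactSpace
  infer_instance

/-- Since the density depends only on the height, `rho` is a product measure. -/
theorem rho_eq_prod :
    rho = ((volume : Measure ℝ).prod ((volume : Measure ℝ).prod
      ((Measure.comap (Subtype.val : Set.Ioi (0 : ℝ) → ℝ) volume).withDensity
        fun t => ENNReal.ofReal (t : ℝ)⁻¹)) : Measure (ℝ × ℝ × Set.Ioi (0 : ℝ))) := by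
  have := sigmaFinite_comap_Ioi
  rw [prod_withDensity_right, prod_withDensity_right]
  · rfl
  · fun_prop
  · fun_prop

instance : SigmaFinite rho := by
  have := sigmaFinite_comap_Ioi
  rw [rho_eq_prod]
  exact inferInstanceAs (SigmaFinite (Measure.prod _ _))

theorem rho_box {b₁ b₂ a L r : ℝ} (ha : 0 < a) (hL : 0 ≤ L) (hr : 0 ≤ r) :
    rho (box b₁ b₂ a L r) = ENNReal.ofReal (2 * L ^ 2 * r) := by
  have := sigmaFinite_comap_Ioi
  have hp : 0 < a * Real.exp (-r) := by positivity
  have hle : a * Real.exp (-r) ≤ a * Real.exp r := by gcongr; linarith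
  have hsub : Set.Icc (a * Real.exp (-r)) (a * Real.exp r) ⊆ Set.Ioi 0 :=
    fun t ht => hp.trans_le ht.1
  have hint : ∫ t in a * Real.exp (-r)..a * Real.exp r, t⁻¹ = 2 * r := by
    rw [integral_inv_of_pos hp (by positivity), mul_div_mul_left _ _ ha.ne', ← Real.exp_sub,
      Real.log_exp]
    ring
  rw [rho_eq_prod]
  change ((volume : Measure ℝ).prod ((volume : Measure ℝ).prod
      ((Measure.comap (Subtype.val : Set.Ioi (0 : ℝ) → ℝ) volume).withDensity
        fun t => ENNReal.ofReal (t : ℝ)⁻¹)) : Measure (ℝ × ℝ × Set.Ioi (0 : ℝ)))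
    (Set.Icc (b₁ - L / 2) (b₁ + L / 2) ×ˢ
      (Set.Icc (b₂ - L / 2) (b₂ + L / 2) ×ˢ (Subtype.val ⁻¹'
        Set.Icc (a * Real.exp (-r)) (a * Real.exp r)))) = _
  rw [Measure.prod_prod, Measure.prod_prod, Real.volume_Icc, Real.volume_Icc,
    withDensity_apply _ (measurable_subtype_coe measurableSet_Icc),
    setLIntegral_subtype measurableSet_Ioi _ (fun t : ℝ => ENNReal.ofReal t⁻¹),
    Subtype.image_preimage_coe, Set.inter_eq_self_of_subset_right hsub,
    ← ofReal_integral_eq_lintegral_ofReal, integral_Icc_eq_integral_Ioc,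
    ← intervalIntegral.integral_of_le hle, hint, ← ENNReal.ofReal_mul (by linarith),
    ← ENNReal.ofReal_mul (by linarith)]
  · congr 1; ring
  · exact ContinuousOn.integrableOn_Icc
      (continuousOn_inv₀.mono fun t ht => (hp.trans_le ht.1).ne')
  · exact (ae_restrict_mem measurableSet_Icc).mono fun t ht => inv_nonneg.2 (hp.trans_le ht.1).le

theorem measurableSet_box (b₁ b₂ a L r : ℝ) : MeasurableSet (box b₁ b₂ a L r) :=
  (measurableSet_Icc.prod (measurableSet_Icc.prod (measurable_subtype_coe measurableSet_Icc)) :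
    MeasurableSet (Set.Icc (b₁ - L / 2) (b₁ + L / 2) ×ˢ
      (Set.Icc (b₂ - L / 2) (b₂ + L / 2) ×ˢ (Subtype.val ⁻¹'
        Set.Icc (a * Real.exp (-r)) (a * Real.exp r))) : Set (ℝ × ℝ × Set.Ioi (0 : ℝ))))

theorem IsAdmissible.rho_box_dilate {a L r : ℝ} (h : IsAdmissible a L r) (b₁ b₂ : ℝ) :
    rho (box b₁ b₂ a (3 * L) (2 * r)) = 18 * rho (box b₁ b₂ a L r) := by
  have ha := h.a_pos
  have hr := h.r_pos
  have hL := h.L_pos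
  rw [rho_box ha (by positivity) (by positivity), rho_box ha hL.le hr.le,
    show (18 : ℝ≥0∞) = ENNReal.ofReal 18 by simp, ← ENNReal.ofReal_mul (by norm_num)]
  congr 1; ring

/-! ### Integral operators on `L¹` -/

theorem enorm_L1_eq_lintegral {X : Type*} [MeasurableSpace X] {μ : Measure X} (f : Lp ℂ 1 μ) :
    ‖f‖ₑ = ∫⁻ x, ‖f x‖ₑ ∂μ := by
  rw [Lp.enorm_def, eLpNorm_one_eq_lintegral_enorm]

section KernelOperator

variable {X : Type*} [MeasurableSpace X] {μ : Measure X} [SFinite μ]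

/-- Tonelli's theorem for the integral operator with kernel `k`, over a set `s`. -/
theorem lintegral_enorm_integral_mul_le {k : X → X → ℂ}
    (hk : AEStronglyMeasurable (Function.uncurry k) (μ.prod μ)) {u : X → ℂ}
    (hu : AEStronglyMeasurable u μ) {s : Set X} {B : ℝ≥0∞}
    (hB : ∀ᵐ y ∂μ, u y ≠ 0 → ∫⁻ x in s, ‖k x y‖ₑ ∂μ ≤ B) :
    ∫⁻ x in s, ‖∫ y, k x y * u y ∂μ‖ₑ ∂μ ≤ B * ∫⁻ y, ‖u y‖ₑ ∂μ := by
  have hle : (μ.restrict s).prod μ ≪ μ.prod μ :=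
    (Measure.absolutelyContinuous_of_le Measure.restrict_le_self).prod .rfl
  have hmeas : AEStronglyMeasurable (Function.uncurry fun x y => k x y * u y)
      ((μ.restrict s).prod μ) := (hk.mul hu.comp_snd).mono_ac hle
  calc ∫⁻ x in s, ‖∫ y, k x y * u y ∂μ‖ₑ ∂μ
      ≤ ∫⁻ x in s, ∫⁻ y, ‖k x y * u y‖ₑ ∂μ ∂μ :=
        lintegral_mono fun x => enorm_integral_le_lintegral_enorm _
    _ = ∫⁻ y, ∫⁻ x in s, ‖k x y * u y‖ₑ ∂μ ∂μ :=
        lintegral_lintegral_swap hmeas.enorm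
    _ ≤ ∫⁻ y, B * ‖u y‖ₑ ∂μ := by
        refine lintegral_mono_ae (hB.mono fun y hy => ?_)
        simp only [enorm_mul]
        rw [lintegral_mul_const' _ _ enorm_ne_top]
        by_cases h0 : u y = 0
        · simp [h0]
        · gcongr; exact hy h0
    _ = _ := lintegral_const_mul'' _ hu.enorm

theorem integrable_prod_kernel_mul {k : X → X → ℂ} {B : ℝ≥0∞} (hBt : B ≠ ∞)
    (hk : AEStronglyMeasurable (Function.uncurry k) (μ.prod μ))
    (hB : ∀ y, ∫⁻ x, ‖k x y‖ₑ ∂μ ≤ B) {u : X → ℂ} (hu : Integrable u μ) :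
    Integrable (fun p : X × X => k p.1 p.2 * u p.2) (μ.prod μ) := by
  have hmeas : AEStronglyMeasurable (fun p : X × X => k p.1 p.2 * u p.2) (μ.prod μ) :=
    hk.mul hu.1.comp_snd
  refine ⟨hmeas, ?_⟩
  rw [HasFiniteIntegral, lintegral_prod_symm _ hmeas.enorm]
  calc ∫⁻ y, ∫⁻ x, ‖k x y * u y‖ₑ ∂μ ∂μ ≤ ∫⁻ y, B * ‖u y‖ₑ ∂μ := by
        refine lintegral_mono fun y => ?_
        simp only [enorm_mul]
        rw [lintegral_mul_const' _ _ enorm_ne_top]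
        gcongr; exact hB y
    _ = B * ∫⁻ y, ‖u y‖ₑ ∂μ := lintegral_const_mul'' _ hu.1.enorm
    _ < ∞ := ENNReal.mul_lt_top hBt.lt_top hu.2

/-- A kernel that is uniformly integrable in the first variable defines a bounded operator on
`L¹` (Schur's test). -/
theorem exists_L1_operator_of_kernel {k : X → X → ℂ} {B : ℝ≥0∞} (hBt : B ≠ ∞)
    (hk : AEStronglyMeasurable (Function.uncurry k) (μ.prod μ))
    (hB : ∀ y, ∫⁻ x, ‖k x y‖ₑ ∂μ ≤ B) :
    ∃ P : Lp ℂ 1 μ →L[ℂ] Lp ℂ 1 μ, ∀ f, P f =ᵐ[μ] fun x => ∫ y, k x y * f y ∂μ := by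
  have hprod (f : Lp ℂ 1 μ) := integrable_prod_kernel_mul hBt hk hB (L1.integrable_coeFn f)
  have hint (f : Lp ℂ 1 μ) : MemLp (fun x => ∫ y, k x y * f y ∂μ) 1 μ :=
    memLp_one_iff_integrable.2 (hprod f).integral_prod_left
  have hcoe (f : Lp ℂ 1 μ) := (hint f).coeFn_toLp
  let P : Lp ℂ 1 μ →ₗ[ℂ] Lp ℂ 1 μ :=
    { toFun := fun f => (hint f).toLp _
      map_add' := fun f g => by
        refine Lp.ext ?_
        filter_upwards [hcoe (f + g), hcoe f, hcoe g, Lp.coeFn_add ((hint f).toLp _)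
          ((hint g).toLp _), (hprod f).prod_right_ae, (hprod g).prod_right_ae]
          with x h1 h2 h3 h4 h5 h6
        rw [h1, h4, Pi.add_apply, h2, h3, ← integral_add h5 h6]
        refine integral_congr_ae ((Lp.coeFn_add f g).mono fun y hy => ?_)
        simp only [hy, Pi.add_apply, mul_add]
      map_smul' := fun c f => by
        refine Lp.ext ?_
        filter_upwards [hcoe (c • f), hcoe f, Lp.coeFn_smul c ((hint f).toLp _)] with x h1 h2 h3
        rw [h1, RingHom.id_apply, h3, Pi.smul_apply, h2, smul_eq_mul, ← integral_const_mul]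
        refine integral_congr_ae ((Lp.coeFn_smul c f).mono fun y hy => ?_)
        simp only [hy, Pi.smul_apply, smul_eq_mul]
        ring }
  have hP (f : Lp ℂ 1 μ) : P f =ᵐ[μ] fun x => ∫ y, k x y * f y ∂μ := hcoe f
  refine ⟨P.mkContinuous B.toReal fun f => ?_, hcoe⟩
  have h : ‖P f‖ₑ ≤ B * ‖f‖ₑ := by
    rw [enorm_L1_eq_lintegral, enorm_L1_eq_lintegral,
      lintegral_congr_ae ((hP f).mono fun x hx => congrArg _ hx)]
    have := lintegral_enorm_integral_mul_le (s := Set.univ) hk (Lp.aestronglyMeasurable f)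
      (B := B) (ae_of_all _ fun y _ => by simpa using hB y)
    simpa using this
  have h' := ENNReal.toReal_mono (ENNReal.mul_ne_top hBt enorm_ne_top) h
  simpa using h'

end KernelOperator

/-! ### Summation over the scales -/

section ScaleSum

/-- The bound for the contribution of the scale `c ^ m` away from a Calderón–Zygmund set of
unit size: the smaller of the bounds given by the size and by the smoothness condition. The exponent
`m + 1` leaves room for a size between `1` and `c`, so that any size reduces to this case by a shift
of `m`. -/
noncomputable def scaleBound (A C α ε c : ℝ) (m : ℤ) : ℝ :=
  min (A * (c ^ m) ^ (-ε)) (A * (C * c ^ (m + 1)) ^ α)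

variable {A C α ε c : ℝ}

theorem scaleBound_nonneg (hA : 0 ≤ A) (hC : 0 ≤ C) (hc : 0 < c) (m : ℤ) :
    0 ≤ scaleBound A C α ε c m := by
  unfold scaleBound
  positivity

theorem summable_scaleBound (hA : 0 ≤ A) (hC : 0 ≤ C) (hα : 0 < α) (hε : 0 < ε) (hc : 1 < c) :
    Summable (scaleBound A C α ε c) := by
  have hc0 : 0 < c := one_pos.trans hc
  have h0 := scaleBound_nonneg (α := α) (ε := ε) hA hC hc0
  refine Summable.of_nat_of_neg ?_ ?_
  · have hq : c ^ (-ε) < 1 := Real.rpow_lt_one_of_one_lt_of_neg hc (by linarith)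
    refine Summable.of_nonneg_of_le (fun n => h0 n) (fun n => min_le_left _ _) ?_
    refine ((summable_geometric_of_lt_one (by positivity) hq).mul_left A).congr fun n => ?_
    rw [zpow_natCast, ← Real.rpow_natCast, ← Real.rpow_natCast, ← Real.rpow_mul hc0.le,
      ← Real.rpow_mul hc0.le]
    congr 2; ring
  · have hq : c ^ (-α) < 1 := Real.rpow_lt_one_of_one_lt_of_neg hc (by linarith)
    refine Summable.of_nonneg_of_le (fun n => h0 _) (fun n => min_le_right _ _) ?_
    refine ((summable_geometric_of_lt_one (by positivity) hq).mul_left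
      (A * (C * c) ^ α)).congr fun n => ?_
    rw [zpow_add₀ hc0.ne', zpow_one, mul_comm (c ^ (-(n : ℤ))) c, ← mul_assoc,
      zpow_neg, zpow_natCast,
      Real.mul_rpow (x := C * c) (by positivity) (by positivity), mul_assoc]
    congr 2
    rw [Real.inv_rpow (by positivity), ← Real.rpow_natCast, ← Real.rpow_natCast,
      ← Real.rpow_mul hc0.le, ← Real.rpow_mul hc0.le, ← Real.rpow_neg hc0.le]
    congr 1; ring

/-- Up to a shift of the scales, the bounds for a set of size `r` are those for unit size. -/
theorem exists_le_scaleBound (hA : 0 ≤ A) (hC : 0 ≤ C) (hα : 0 < α) (hε : 0 < ε) (hc : 1 < c)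
    {r : ℝ} (hr : 0 < r) : ∃ k : ℤ, ∀ j : ℤ,
      A * (c ^ j * r) ^ (-ε) ≤ A * (c ^ (j + k)) ^ (-ε) ∧
      A * (c ^ j * (C * r)) ^ α ≤ A * (C * c ^ (j + k + 1)) ^ α := by
  have hc0 : 0 < c := one_pos.trans hc
  obtain ⟨k, hk1, hk2⟩ := exists_mem_Ico_zpow hr hc
  refine ⟨k, fun j => ⟨?_, ?_⟩⟩
  · refine mul_le_mul_of_nonneg_left ?_ hA
    refine Real.rpow_le_rpow_of_nonpos (by positivity) ?_ (by linarith)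
    rw [zpow_add₀ hc0.ne']
    gcongr
  · refine mul_le_mul_of_nonneg_left (Real.rpow_le_rpow (by positivity) ?_ hα.le) hA
    rw [add_assoc, zpow_add₀ hc0.ne', mul_left_comm]
    gcongr

end ScaleSum

/-! ### Estimates for a single atom -/

section AtomNorms

variable {u : G → ℂ} {R : Set G}

theorem eLpNorm_le_of_support_of_bound (hR : MeasurableSet R) (hu : AEStronglyMeasurable u rho)
    (hsupp : ∀ᵐ x ∂rho, x ∉ R → u x = 0) (hbd : eLpNorm u ∞ rho ≤ (rho R)⁻¹) (q : ℝ≥0∞) :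
    eLpNorm u q rho ≤ (rho R)⁻¹ * rho R ^ (1 / q.toReal) := by
  have h1 : u =ᵐ[rho] R.indicator u := by
    filter_upwards [hsupp] with x hx
    by_cases hxR : x ∈ R
    · simp [hxR]
    · simp [hxR, hx hxR]
  calc eLpNorm u q rho = eLpNorm u q (rho.restrict R) := by
        rw [← eLpNorm_indicator_eq_eLpNorm_restrict hR]; exact eLpNorm_congr_ae h1
    _ ≤ eLpNorm u ∞ (rho.restrict R) * rho R ^ (1 / q.toReal) := by
        have := eLpNorm_le_eLpNorm_mul_rpow_measure_univ (μ := rho.restrict R) (p := q) (q := ∞)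
          le_top hu.restrict
        simpa using this
    _ ≤ _ := by gcongr; exact (eLpNorm_mono_measure u Measure.restrict_le_self).trans hbd

end AtomNorms

section KernelEstimates

variable {k : G → G → ℂ} {A α ε t r a L b₁ b₂ : ℝ}

theorem lintegral_kernel_le (ht : 0 ≤ t) (hε : 0 ≤ ε) {y : G}
    (hsize : ∫⁻ x, ‖k x y‖ₑ * ENNReal.ofReal ((1 + t * hdist x y) ^ ε) ∂rho ≤ ENNReal.ofReal A) :
    ∫⁻ x, ‖k x y‖ₑ ∂rho ≤ ENNReal.ofReal A := by
  refine le_trans (lintegral_mono fun x => ?_) hsize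
  refine le_mul_of_one_le_right' (ENNReal.one_le_ofReal.2 (Real.one_le_rpow ?_ hε))
  have := mul_nonneg ht (hdist_nonneg x y)
  linarith

/-- The size condition controls a scale `t` with `t r` large: away from the dilated set the
distance to the Calderón–Zygmund set is at least `r`. -/
theorem IsAdmissible.lintegral_compl_kernel_le (h : IsAdmissible a L r) (ht : 0 < t)
    (hε : 0 ≤ ε) (hA : 0 ≤ A) {y : G} (hy : y ∈ box b₁ b₂ a L r)
    (hsize : ∫⁻ x, ‖k x y‖ₑ * ENNReal.ofReal ((1 + t * hdist x y) ^ ε) ∂rho ≤ ENNReal.ofReal A) :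
    ∫⁻ x in (box b₁ b₂ a (3 * L) (2 * r))ᶜ, ‖k x y‖ₑ ∂rho ≤
      ENNReal.ofReal (A * (t * r) ^ (-ε)) := by
  have hr := h.r_pos
  calc ∫⁻ x in (box b₁ b₂ a (3 * L) (2 * r))ᶜ, ‖k x y‖ₑ ∂rho
      ≤ ∫⁻ x in (box b₁ b₂ a (3 * L) (2 * r))ᶜ,
          ‖k x y‖ₑ * ENNReal.ofReal ((1 + t * hdist x y) ^ ε) *
            ENNReal.ofReal ((t * r) ^ (-ε)) ∂rho := by
        refine setLIntegral_mono' (measurableSet_box _ _ _ _ _).compl fun x hx => ?_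
        have hd : r ≤ hdist x y := not_lt.1 fun hlt => hx (h.mem_box_of_hdist_lt hy hlt)
        rw [mul_assoc, ← ENNReal.ofReal_mul (by have := hdist_nonneg x y; positivity)]
        refine le_mul_of_one_le_right' (ENNReal.one_le_ofReal.2 ?_)
        rw [Real.rpow_neg (by positivity), ← div_eq_mul_inv, one_le_div (by positivity)]
        refine Real.rpow_le_rpow (by positivity) ?_ hε
        have := mul_le_mul_of_nonneg_left hd ht.le
        linarith
    _ = (∫⁻ x in (box b₁ b₂ a (3 * L) (2 * r))ᶜ,
          ‖k x y‖ₑ * ENNReal.ofReal ((1 + t * hdist x y) ^ ε) ∂rho) *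
            ENNReal.ofReal ((t * r) ^ (-ε)) := lintegral_mul_const' _ _ ENNReal.ofReal_ne_top
    _ ≤ ENNReal.ofReal A * ENNReal.ofReal ((t * r) ^ (-ε)) := by
        gcongr; exact (setLIntegral_le_lintegral _ _).trans hsize
    _ = _ := (ENNReal.ofReal_mul hA).symm

variable {u : G → ℂ}

theorem IsAdmissible.lintegral_compl_le_of_size (h : IsAdmissible a L r) (ht : 0 < t)
    (hε : 0 ≤ ε) (hA : 0 ≤ A)
    (hk : AEStronglyMeasurable (Function.uncurry k) (rho.prod rho))
    (hsize : ∀ y, ∫⁻ x, ‖k x y‖ₑ * ENNReal.ofReal ((1 + t * hdist x y) ^ ε) ∂rho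
      ≤ ENNReal.ofReal A)
    (hu : AEStronglyMeasurable u rho) (hu1 : ∫⁻ y, ‖u y‖ₑ ∂rho ≤ 1)
    (hsupp : ∀ᵐ y ∂rho, y ∉ box b₁ b₂ a L r → u y = 0) :
    ∫⁻ x in (box b₁ b₂ a (3 * L) (2 * r))ᶜ, ‖∫ y, k x y * u y ∂rho‖ₑ ∂rho ≤
      ENNReal.ofReal (A * (t * r) ^ (-ε)) := by
  refine (lintegral_enorm_integral_mul_le hk hu (B := ENNReal.ofReal (A * (t * r) ^ (-ε)))
    (hsupp.mono fun y hy hne => ?_)).trans (mul_le_of_le_one_right' hu1)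
  exact h.lintegral_compl_kernel_le ht hε hA (not_imp_comm.1 hy hne) (hsize y)

/-- The smoothness condition controls a scale `t` with `t r` small: since `u` has mean zero, the
kernel may be replaced by its difference with the value at the centre of the set. -/
theorem IsAdmissible.lintegral_le_of_diff (h : IsAdmissible a L r) (ht : 0 < t)
    (hα : 0 ≤ α) (hA : 0 ≤ A) {B : ℝ≥0∞} (hBt : B ≠ ∞)
    (hk : AEStronglyMeasurable (Function.uncurry k) (rho.prod rho))
    (hk' : ∀ y, AEStronglyMeasurable (fun x => k x y) rho)
    (hB : ∀ y, ∫⁻ x, ‖k x y‖ₑ ∂rho ≤ B)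
    (hdiff : ∀ y z, ∫⁻ x, ‖k x y - k x z‖ₑ ∂rho ≤ ENNReal.ofReal (A * (t * hdist y z) ^ α))
    (hu : Integrable u rho) (hu1 : ∫⁻ y, ‖u y‖ₑ ∂rho ≤ 1) (hu0 : ∫ y, u y ∂rho = 0)
    (hsupp : ∀ᵐ y ∂rho, y ∉ box b₁ b₂ a L r → u y = 0) :
    ∫⁻ x, ‖∫ y, k x y * u y ∂rho‖ₑ ∂rho ≤
      ENNReal.ofReal (A * (t * (Real.exp 10 * r)) ^ α) := by
  set z := G.mk b₁ b₂ a h.a_pos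
  have hint := (integrable_prod_kernel_mul hBt hk hB hu).prod_right_ae
  have heq : ∀ᵐ x ∂rho, ‖∫ y, k x y * u y ∂rho‖ₑ = ‖∫ y, (k x y - k x z) * u y ∂rho‖ₑ := by
    filter_upwards [hint] with x hx
    simp only [sub_mul]
    rw [integral_sub hx (hu.const_mul _), integral_const_mul, hu0, mul_zero, sub_zero]
  have hmeas : AEStronglyMeasurable (Function.uncurry fun x y => k x y - k x z)
      (rho.prod rho) := hk.sub (hk' z).comp_fst
  have key := lintegral_enorm_integral_mul_le (s := Set.univ) hmeas hu.1
    (B := ENNReal.ofReal (A * (t * (Real.exp 10 * r)) ^ α)) (hsupp.mono fun y hy hne => by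
      rw [Measure.restrict_univ]
      refine (hdiff y z).trans (ENNReal.ofReal_le_ofReal ?_)
      have h0 := hdist_nonneg y z
      have h1 := h.hdist_center_le (not_imp_comm.1 hy hne)
      gcongr)
  rw [Measure.restrict_univ] at key
  rw [lintegral_congr_ae heq]
  exact key.trans (mul_le_of_le_one_right' hu1)

end KernelEstimates

section AtomEstimate

variable {Tj : ℤ → Lp ℂ 2 rho →L[ℂ] Lp ℂ 2 rho} {K : ℤ → G → G → ℂ}
  {P : ℤ → Lp ℂ 1 rho →L[ℂ] Lp ℂ 1 rho} {A α ε c : ℝ}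

/-- The extensions to `L¹` agree with the given operators on `L¹ ∩ L²`. -/
theorem coeFn_L1_eq_L2 (hker : ∀ j, HasIntegralKernel (Tj j) (K j))
    (hP : ∀ j f, P j f =ᵐ[rho] fun x => ∫ y, K j x y * f y ∂rho) {f : Lp ℂ 1 rho}
    {g : Lp ℂ 2 rho} (hfg : f =ᵐ[rho] g) (F : Finset ℤ) :
    (∑ j ∈ F, P j f : Lp ℂ 1 rho) =ᵐ[rho] (∑ j ∈ F, Tj j g : Lp ℂ 2 rho) := by
  have hg : Integrable g rho := (L1.integrable_coeFn f).congr hfg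
  have h1 (j : ℤ) : P j f =ᵐ[rho] Tj j g := by
    filter_upwards [hP j f, (hker j).2.2 g hg] with x hx hx'
    rw [hx, hx'.2]
    exact integral_congr_ae (hfg.mono fun y hy => by simp only [hy])
  induction F using Finset.induction_on with
  | empty =>
    simp only [Finset.sum_empty]
    exact (Lp.coeFn_zero _ _ _).trans (Lp.coeFn_zero _ _ _).symm
  | insert j F hj ih =>
    rw [Finset.sum_insert hj, Finset.sum_insert hj]
    exact (Lp.coeFn_add _ _).trans (((h1 j).add ih).trans (Lp.coeFn_add _ _).symm)

/-- The part of an image near the Calderón–Zygmund set is controlled by the `L²` theory, the part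
far away by the kernels, scale by scale. The factor `κ` is `ρ(R') ^ (1/2)` for the dilated set `R'`,
and the shift `k` is the size of the set on the logarithmic scale with base `c`. -/
theorem IsAtom.exists_estimate (hker : ∀ j, HasIntegralKernel (Tj j) (K j))
    (hP : ∀ j f, P j f =ᵐ[rho] fun x => ∫ y, K j x y * f y ∂rho)
    (hα : 0 < α) (hA : 0 < A) (hε : 0 < ε) (hc : 1 < c)
    (hsize : ∀ (j : ℤ) (y : G),
      ∫⁻ x, ‖K j x y‖ₑ * ENNReal.ofReal ((1 + c ^ j * hdist x y) ^ ε) ∂rho ≤ ENNReal.ofReal A)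
    (hdiff : ∀ (j : ℤ) (y z : G), ∫⁻ x, ‖K j x y - K j x z‖ₑ ∂rho
      ≤ ENNReal.ofReal (A * (c ^ j * hdist y z) ^ α))
    {u : Lp ℂ 1 rho} (hu : IsAtom u) :
    ∃ (v : Lp ℂ 2 rho) (κ : ℝ) (k : ℤ), u =ᵐ[rho] v ∧ 0 ≤ κ ∧ κ * ‖v‖ ≤ 5 ∧
      ∀ F : Finset ℤ, ‖∑ j ∈ F, P j u‖ ≤
        κ * ‖∑ j ∈ F, Tj j v‖ + ∑ j ∈ F, scaleBound A (Real.exp 10) α ε c (j + k) := by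
  obtain ⟨R, ⟨b₁, b₂, a, L, r, ha, hL, hr, rfl, hsm, hlg⟩, hsupp, hbd, hu0⟩ := hu
  have h : IsAdmissible a L r := ⟨ha, hL, hr, hsm, hlg⟩
  set R := box b₁ b₂ a L r
  set R' := box b₁ b₂ a (3 * L) (2 * r)
  have hc0 : 0 < c := one_pos.trans hc
  have hR : rho R = ENNReal.ofReal (2 * L ^ 2 * r) := rho_box ha hL.le hr.le
  have hR0 : rho R ≠ 0 := by 
    rw [hR, ne_eq, ENNReal.ofReal_eq_zero, not_le]; positivity
  have hRt : rho R ≠ ∞ := by rw [hR]; exact ENNReal.ofReal_ne_top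
  have hR' : rho R' = 18 * rho R := h.rho_box_dilate b₁ b₂
  have hum := Lp.aestronglyMeasurable u
  have hnorm := eLpNorm_le_of_support_of_bound (measurableSet_box b₁ b₂ a L r) hum hsupp hbd
  have hu1 : ∫⁻ y, ‖u y‖ₑ ∂rho ≤ 1 := by
    have := hnorm 1
    rw [eLpNorm_one_eq_lintegral_enorm] at this
    refine this.trans ?_
    simp
  have hu2 : eLpNorm u 2 rho ≤ (rho R)⁻¹ * rho R ^ (1 / 2 : ℝ) := by simpa using hnorm 2
  have hmem : MemLp u 2 rho := ⟨hum, hu2.trans_lt (ENNReal.mul_lt_top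
    (ENNReal.inv_lt_top.2 (pos_iff_ne_zero.2 hR0))
    (ENNReal.rpow_lt_top_of_nonneg (by norm_num) hRt))⟩
  obtain ⟨m, hm⟩ := exists_le_scaleBound hA.le (Real.exp_pos 10).le hα hε hc hr
  have hv : u =ᵐ[rho] hmem.toLp u := hmem.coeFn_toLp.symm
  have hκt : rho R' ^ (1 / 2 : ℝ) ≠ ∞ := by
    rw [hR']
    exact ENNReal.rpow_ne_top_of_nonneg (by norm_num) (ENNReal.mul_ne_top (by simp) hRt)
  refine ⟨hmem.toLp u, (rho R' ^ (1 / 2 : ℝ)).toReal, m, hv, ENNReal.toReal_nonneg, ?_,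
    fun F => ?_⟩
  · -- `ρ(R')^(1/2) ‖u‖₂ ≤ (ρ(R') / ρ(R))^(1/2) = √18`
    have e1 : rho R ^ (1 / 2 : ℝ) * rho R ^ (1 / 2 : ℝ) = rho R := by
      rw [← ENNReal.rpow_add _ _ hR0 hRt]; norm_num
    have e2 : (18 : ℝ≥0∞) ^ (1 / 2 : ℝ) ≤ 5 := by
      calc (18 : ℝ≥0∞) ^ (1 / 2 : ℝ) ≤ (5 ^ (2 : ℝ)) ^ (1 / 2 : ℝ) := by
            gcongr; norm_num
        _ = 5 := by rw [← ENNReal.rpow_mul]; norm_num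
    have e3 : rho R' ^ (1 / 2 : ℝ) * eLpNorm u 2 rho ≤ 5 := by
      calc rho R' ^ (1 / 2 : ℝ) * eLpNorm u 2 rho
          ≤ 18 ^ (1 / 2 : ℝ) * rho R ^ (1 / 2 : ℝ) * ((rho R)⁻¹ * rho R ^ (1 / 2 : ℝ)) := by
            rw [hR', ENNReal.mul_rpow_of_nonneg _ _ (by norm_num)]
            gcongr
        _ = 18 ^ (1 / 2 : ℝ) * ((rho R)⁻¹ * (rho R ^ (1 / 2 : ℝ) * rho R ^ (1 / 2 : ℝ))) := by ring
        _ = 18 ^ (1 / 2 : ℝ) := by rw [e1, ENNReal.inv_mul_cancel hR0 hRt, mul_one]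
        _ ≤ 5 := e2
    rw [Lp.norm_toLp, ← ENNReal.toReal_mul]
    exact (ENNReal.toReal_mono (by simp) e3).trans (by simp)
  · have hnear : ∫⁻ x in R', ‖(∑ j ∈ F, P j u : Lp ℂ 1 rho) x‖ₑ ∂rho ≤
        rho R' ^ (1 / 2 : ℝ) * ‖∑ j ∈ F, Tj j (hmem.toLp u)‖ₑ := by
      have hae := coeFn_L1_eq_L2 hker hP hv F
      have h1 := eLpNorm_le_eLpNorm_mul_rpow_measure_univ (μ := rho.restrict R') (p := 1) (q := 2)
        (by norm_num) (Lp.aestronglyMeasurable (∑ j ∈ F, Tj j (hmem.toLp u))).restrict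
      rw [eLpNorm_one_eq_lintegral_enorm] at h1
      rw [lintegral_congr_ae (ae_restrict_of_ae (hae.mono fun x hx => congrArg _ hx)),
        mul_comm, Lp.enorm_def]
      refine h1.trans ?_
      rw [Measure.restrict_apply_univ]
      have : (1 / (1 : ℝ≥0∞).toReal - 1 / (2 : ℝ≥0∞).toReal) = 1 / 2 := by norm_num
      rw [this]
      gcongr
      exact Measure.restrict_le_self
    have hscale (j : ℤ) : ∫⁻ x in R'ᶜ, ‖P j u x‖ₑ ∂rho ≤
        ENNReal.ofReal (scaleBound A (Real.exp 10) α ε c (j + m)) := by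
      have ht : 0 < c ^ j := by positivity
      rw [lintegral_congr_ae (ae_restrict_of_ae ((hP j u).mono fun x hx => congrArg _ hx)),
        scaleBound, ENNReal.ofReal_min]
      refine le_min ?_ ?_
      · exact (h.lintegral_compl_le_of_size ht hε.le hA.le (hker j).1 (hsize j) hum hu1
          hsupp).trans (ENNReal.ofReal_le_ofReal (hm j).1)
      · exact (setLIntegral_le_lintegral _ _).trans ((h.lintegral_le_of_diff ht hα.le hA.le
          ENNReal.ofReal_ne_top (hker j).1 (hker j).2.1
          (fun y => lintegral_kernel_le ht.le hε.le (hsize j y)) (hdiff j)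
          (L1.integrable_coeFn u) hu1 hu0 hsupp).trans (ENNReal.ofReal_le_ofReal (hm j).2))
    have hfar : ∫⁻ x in R'ᶜ, ‖(∑ j ∈ F, P j u : Lp ℂ 1 rho) x‖ₑ ∂rho ≤
        ∑ j ∈ F, ENNReal.ofReal (scaleBound A (Real.exp 10) α ε c (j + m)) := by
      refine le_trans ?_ (Finset.sum_le_sum fun j _ => hscale j)
      rw [← lintegral_finsetSum' _ fun j _ => (Lp.aestronglyMeasurable (P j u)).restrict.enorm]
      refine lintegral_mono_ae (ae_restrict_of_ae ?_)
      filter_upwards [Lp.coeFn_finsetSum F fun j => P j u] with x hx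
      rw [hx, Finset.sum_apply]
      exact enorm_sum_le _ _
    have htot : ‖∑ j ∈ F, P j u‖ₑ ≤ rho R' ^ (1 / 2 : ℝ) * ‖∑ j ∈ F, Tj j (hmem.toLp u)‖ₑ +
        ∑ j ∈ F, ENNReal.ofReal (scaleBound A (Real.exp 10) α ε c (j + m)) := by
      rw [enorm_L1_eq_lintegral,
        ← lintegral_add_compl _ (measurableSet_box b₁ b₂ a (3 * L) (2 * r))]
      exact add_le_add hnear hfar
    have hsb (j : ℤ) := scaleBound_nonneg (α := α) (ε := ε) hA.le (Real.exp_pos 10).le hc0 (j + m)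
    rw [← ENNReal.ofReal_sum_of_nonneg fun j _ => hsb j] at htot
    have hfin : rho R' ^ (1 / 2 : ℝ) * ‖∑ j ∈ F, Tj j (hmem.toLp u)‖ₑ ≠ ∞ :=
      ENNReal.mul_ne_top hκt enorm_ne_top
    have := ENNReal.toReal_mono (ENNReal.add_ne_top.2 ⟨hfin, ENNReal.ofReal_ne_top⟩) htot
    rwa [ENNReal.toReal_add hfin ENNReal.ofReal_ne_top, ENNReal.toReal_mul,
      ENNReal.toReal_ofReal (Finset.sum_nonneg fun j _ => hsb j), toReal_enorm, toReal_enorm]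
      at this

end AtomEstimate

section Sums

variable {Tj : ℤ → Lp ℂ 2 rho →L[ℂ] Lp ℂ 2 rho} {K : ℤ → G → G → ℂ}
  {P : ℤ → Lp ℂ 1 rho →L[ℂ] Lp ℂ 1 rho} {A α ε c : ℝ}

/-- The symmetric partial sums are uniformly bounded and convergent in `L¹` on atoms. -/
theorem exists_atom_bound (hker : ∀ j, HasIntegralKernel (Tj j) (K j))
    (hP : ∀ j f, P j f =ᵐ[rho] fun x => ∫ y, K j x y * f y ∂rho)
    (hconv : ∀ f, CauchySeq fun N : ℕ => ∑ j ∈ Finset.Icc (-(N : ℤ)) N, Tj j f)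
    (hα : 0 < α) (hA : 0 < A) (hε : 0 < ε) (hc : 1 < c)
    (hsize : ∀ (j : ℤ) (y : G),
      ∫⁻ x, ‖K j x y‖ₑ * ENNReal.ofReal ((1 + c ^ j * hdist x y) ^ ε) ∂rho ≤ ENNReal.ofReal A)
    (hdiff : ∀ (j : ℤ) (y z : G), ∫⁻ x, ‖K j x y - K j x z‖ₑ ∂rho
      ≤ ENNReal.ofReal (A * (c ^ j * hdist y z) ^ α)) :
    ∃ D : ℝ≥0, ∀ u, IsAtom u →
      (∀ N : ℕ, ‖∑ j ∈ Finset.Icc (-(N : ℤ)) N, P j u‖ ≤ D) ∧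
      CauchySeq fun N : ℕ => ∑ j ∈ Finset.Icc (-(N : ℤ)) N, P j u := by
  have hc0 : 0 < c := one_pos.trans hc
  obtain ⟨M, hM⟩ : ∃ M, ∀ N : ℕ, ‖∑ j ∈ Finset.Icc (-(N : ℤ)) N, Tj j‖ ≤ M := by
    refine banach_steinhaus fun f => ?_
    obtain ⟨B, hB⟩ := (hconv f).norm_bddAbove
    exact ⟨B, fun N => by simpa [_root_.sum_apply] using hB ⟨N, rfl⟩⟩
  have hM0 : 0 ≤ M := (norm_nonneg _).trans (hM 0)
  have hb0 := scaleBound_nonneg (A := A) (α := α) (ε := ε) hA.le (Real.exp_pos 10).le hc0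
  have hbs := summable_scaleBound (A := A) (α := α) (ε := ε) hA.le (Real.exp_pos 10).le hα hε hc
  have hS0 : 0 ≤ ∑' m, scaleBound A (Real.exp 10) α ε c m := tsum_nonneg hb0
  refine ⟨⟨5 * M + ∑' m, scaleBound A (Real.exp 10) α ε c m, by positivity⟩, fun u hu => ?_⟩
  obtain ⟨v, κ, k, -, hκ, hκv, hest⟩ := hu.exists_estimate hker hP hα hA hε hc hsize hdiff
  have hbs' : Summable fun j => scaleBound A (Real.exp 10) α ε c (j + k) :=
    (Equiv.addRight k).summable_iff.2 hbs
  refine ⟨fun N => ?_, ?_⟩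
  · refine (hest _).trans (add_le_add ?_ ?_)
    · have h1 := (∑ j ∈ Finset.Icc (-(N : ℤ)) N, Tj j).le_of_opNorm_le (hM N) v
      rw [_root_.sum_apply] at h1
      calc κ * ‖∑ j ∈ Finset.Icc (-(N : ℤ)) N, Tj j v‖ ≤ κ * (M * ‖v‖) := by gcongr
        _ = κ * ‖v‖ * M := by ring
        _ ≤ 5 * M := by gcongr
    · rw [← (Equiv.addRight k).tsum_eq]
      exact hbs'.sum_le_tsum _ fun j _ => hb0 _
  · rw [Metric.cauchySeq_iff']
    intro δ hδ
    -- the difference of two partial sums is a sum over scales outside any given finite set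
    obtain ⟨s, hs⟩ := summable_iff_vanishing_norm.1 hbs' (δ / 2) (by positivity)
    obtain ⟨N₁, hN₁⟩ := Metric.cauchySeq_iff'.1 (hconv v) (δ / 4 / (κ + 1)) (by positivity)
    obtain ⟨N₂, hN₂⟩ : ∃ N₂ : ℕ, s ⊆ Finset.Icc (-(N₂ : ℤ)) N₂ := by
      refine ⟨s.sup Int.natAbs, fun j hj => ?_⟩
      have := Finset.le_sup (f := Int.natAbs) hj
      rw [Finset.mem_Icc]
      omega
    refine ⟨max N₁ N₂, fun n hn => ?_⟩
    have hsub : Finset.Icc (-((max N₁ N₂ : ℕ) : ℤ)) (max N₁ N₂ : ℕ) ⊆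
        Finset.Icc (-(n : ℤ)) n := Finset.Icc_subset_Icc (by omega) (by omega)
    rw [dist_eq_norm, ← Finset.sum_sdiff_eq_sub hsub]
    refine (hest _).trans_lt ?_
    have h1 : ‖∑ j ∈ Finset.Icc (-(n : ℤ)) n \
        Finset.Icc (-((max N₁ N₂ : ℕ) : ℤ)) (max N₁ N₂ : ℕ), Tj j v‖ ≤ δ / 2 / (κ + 1) := by
      rw [Finset.sum_sdiff_eq_sub hsub, ← dist_eq_norm]
      refine (dist_triangle_right _ _ _).trans ((add_le_add (hN₁ n (by omega)).le
        (hN₁ (max N₁ N₂) (le_max_left _ _)).le).trans_eq ?_)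
      ring
    have h2 := hs (Finset.Icc (-(n : ℤ)) n \
        Finset.Icc (-((max N₁ N₂ : ℕ) : ℤ)) (max N₁ N₂ : ℕ)) (by
      refine Finset.disjoint_of_subset_right (hN₂.trans (Finset.Icc_subset_Icc ?_ ?_))
        Finset.sdiff_disjoint <;> omega)
    have h3 : κ * (δ / 2 / (κ + 1)) ≤ δ / 2 := by
      rw [mul_div_assoc', div_le_iff₀ (by positivity)]
      nlinarith
    have h4 := (mul_le_mul_of_nonneg_left h1 hκ).trans h3
    have h5 := (le_abs_self _).trans_lt h2
    linarith

end Sums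

/-! ### Operators on the Hardy space -/

section Hardy

variable {f : Lp ℂ 1 rho} {lam : ℕ → ℂ} {u : ℕ → Lp ℂ 1 rho}

theorem IsAtom.mem_hardy {u : Lp ℂ 1 rho} (hu : IsAtom u) : u ∈ hardy := by
  refine ⟨Pi.single 0 1, fun _ => u, fun _ => hu, ?_, ?_⟩
  · refine (hasSum_single 0 fun n hn => ?_).summable
    simp [hn]
  · convert hasSum_single 0 (f := fun j => (Pi.single 0 1 : ℕ → ℂ) j • u) fun n hn => ?_ using 1
    · simp
    · simp [hn]

theorem IsAtomicDecomposition.tsum_enorm_ne_top (h : IsAtomicDecomposition f lam u) :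
    ∑' j, ‖lam j‖ₑ ≠ ∞ := by
  simp only [← ofReal_norm]
  rw [← ENNReal.ofReal_tsum_of_nonneg (fun _ => norm_nonneg _) h.2.1]
  exact ENNReal.ofReal_ne_top

theorem hardyNorm_ne_top (hf : f ∈ hardy) : hardyNorm f ≠ ∞ := by
  obtain ⟨lam, u, h⟩ := hf
  exact ne_top_of_le_ne_top h.tsum_enorm_ne_top (iInf₂_le_of_le lam u (iInf_le _ h))

theorem IsAtomicDecomposition.hardyNorm_sub_le (h : IsAtomicDecomposition f lam u) (n : ℕ) :
    hardyNorm (f - ∑ j ∈ Finset.range n, lam j • u j) ≤ ∑' j, ‖lam (j + n)‖ₑ :=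
  iInf₂_le_of_le (fun j => lam (j + n)) (fun j => u (j + n)) (iInf_le _
    ⟨fun _ => h.1 _, (summable_nat_add_iff n).2 h.2.1, (hasSum_nat_add_iff' n).2 h.2.2⟩)

theorem IsAtomicDecomposition.tendsto_tail (h : IsAtomicDecomposition f lam u) :
    Tendsto (fun n => ∑' j, ‖lam (j + n)‖ₑ) atTop (𝓝 0) := by
  exact ENNReal.tendsto_sum_nat_add (fun j => ‖lam j‖ₑ) h.tsum_enorm_ne_top

/-- A linear operator that is bounded with respect to the Hardy norm is determined by its values
on atoms. -/
theorem eq_zero_of_forall_atom {D : hardy →ₗ[ℂ] Lp ℂ 1 rho} {C : ℝ≥0}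
    (hD : ∀ f : hardy, ‖D f‖ₑ ≤ C * hardyNorm f)
    (h0 : ∀ (u : Lp ℂ 1 rho) (hu : IsAtom u), D ⟨u, hu.mem_hardy⟩ = 0) : D = 0 := by
  ext1 ⟨f, hf⟩
  obtain ⟨lam, u, h⟩ := id hf
  let s (n : ℕ) : hardy := ∑ j ∈ Finset.range n, lam j • ⟨u j, (h.1 j).mem_hardy⟩
  have hs (n : ℕ) : D (s n) = 0 := by
    simp only [s, map_sum, map_smul, h0 _ (h.1 _), smul_zero, Finset.sum_const_zero]
  have hle (n : ℕ) : ‖D ⟨f, hf⟩‖ₑ ≤ C * ∑' j, ‖lam (j + n)‖ₑ := by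
    have h1 := hD (⟨f, hf⟩ - s n)
    rw [map_sub, hs, sub_zero] at h1
    refine h1.trans ?_
    gcongr
    have h2 : ((⟨f, hf⟩ - s n : hardy) : Lp ℂ 1 rho) =
        f - ∑ j ∈ Finset.range n, lam j • u j := by
      simp [s]
    rw [h2]
    exact h.hardyNorm_sub_le n
  have hlim : Tendsto (fun n => (C : ℝ≥0∞) * ∑' j, ‖lam (j + n)‖ₑ) atTop (𝓝 0) := by
    simpa using ENNReal.Tendsto.const_mul h.tendsto_tail (Or.inr ENNReal.coe_ne_top)
  have := ge_of_tendsto' hlim hle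
  simpa using this

/-- If a sequence of operators on `L¹` is uniformly bounded and convergent on atoms, it converges
on the Hardy space; the bound is inherited by the limit. -/
theorem exists_tendsto_of_atoms {Q : ℕ → Lp ℂ 1 rho →L[ℂ] Lp ℂ 1 rho} {D : ℝ≥0}
    (hbd : ∀ u, IsAtom u → ∀ N, ‖Q N u‖ ≤ D) (hconv : ∀ u, IsAtom u → CauchySeq fun N => Q N u)
    (hf : f ∈ hardy) :
    ∃ g, Tendsto (fun N => Q N f) atTop (𝓝 g) ∧ ‖g‖ₑ ≤ D * hardyNorm f := by
  have hQ {lam : ℕ → ℂ} {u : ℕ → Lp ℂ 1 rho} (h : IsAtomicDecomposition f lam u) (N : ℕ) :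
      HasSum (fun j => lam j • Q N (u j)) (Q N f) := by
    simpa using h.2.2.mapL (Q N)
  have hterm {lam : ℕ → ℂ} {u : ℕ → Lp ℂ 1 rho} (h : IsAtomicDecomposition f lam u) (N j : ℕ) :
      ‖lam j • Q N (u j)‖ ≤ ‖lam j‖ * D := by
    rw [norm_smul]; gcongr; exact hbd _ (h.1 j) N
  have hlim : ∃ g, Tendsto (fun N => Q N f) atTop (𝓝 g) := by
    obtain ⟨lam, u, h⟩ := hf
    choose w hw using fun j => cauchySeq_tendsto_of_complete (hconv _ (h.1 j))
    refine ⟨∑' j, lam j • w j, ?_⟩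
    simp only [← (hQ h _).tsum_eq]
    exact tendsto_tsum_of_dominated_convergence (h.2.1.mul_right (D : ℝ))
      (fun j => (hw j).const_smul _) (Eventually.of_forall fun N j => hterm h N j)
  obtain ⟨g, hg⟩ := hlim
  refine ⟨g, hg, ?_⟩
  rw [mul_comm, ← ENNReal.div_le_iff_le_mul (Or.inr (hardyNorm_ne_top hf))
    (Or.inl ENNReal.coe_ne_top)]
  refine le_iInf₂ fun lam u => le_iInf fun h => ENNReal.div_le_of_le_mul ?_
  refine le_of_tendsto' hg.enorm fun N => ?_
  have h1 : ‖Q N f‖ ≤ (∑' j, ‖lam j‖) * D := by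
    rw [← (hQ h N).tsum_eq]
    exact tsum_of_norm_bounded (h.2.1.hasSum.mul_right (D : ℝ)) (hterm h N)
  rw [← ofReal_norm]
  refine (ENNReal.ofReal_le_ofReal h1).trans_eq ?_
  rw [ENNReal.ofReal_mul (tsum_nonneg fun _ => norm_nonneg _),
    ENNReal.ofReal_tsum_of_nonneg (fun _ => norm_nonneg _) h.2.1, ENNReal.ofReal_coe_nnreal]
  simp only [ofReal_norm]

end Hardy

end SolvGroup

theorem mainTheorem7
    (T : Lp ℂ 2 SolvGroup.rho →L[ℂ] Lp ℂ 2 SolvGroup.rho)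
    (Tj : ℤ → Lp ℂ 2 SolvGroup.rho →L[ℂ] Lp ℂ 2 SolvGroup.rho)
    (K : ℤ → SolvGroup.G → SolvGroup.G → ℂ)
    (hsum : ∀ f : Lp ℂ 2 SolvGroup.rho,
      Tendsto (fun N : ℕ => ∑ j ∈ Finset.Icc (-(N : ℤ)) (N : ℤ), Tj j f) atTop (𝓝 (T f)))
    (hker : ∀ j : ℤ, SolvGroup.HasIntegralKernel (Tj j) (K j))
    (α A ε c : ℝ) (hα : 0 < α) (hA : 0 < A) (hε : 0 < ε) (hc : 1 < c)
    (hsize : ∀ (j : ℤ) (y : SolvGroup.G),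
      ∫⁻ x, ‖K j x y‖ₑ * ENNReal.ofReal ((1 + c ^ j * SolvGroup.hdist x y) ^ ε) ∂SolvGroup.rho
        ≤ ENNReal.ofReal A)
    (hdiff : ∀ (j : ℤ) (y z : SolvGroup.G),
      ∫⁻ x, ‖K j x y - K j x z‖ₑ ∂SolvGroup.rho
        ≤ ENNReal.ofReal (A * (c ^ j * SolvGroup.hdist y z) ^ α)) :
    SolvGroup.BoundedHardyToL1 T := by
  open SolvGroup in
  have hc0 : 0 < c := one_pos.trans hc
  choose P hP using fun j => exists_L1_operator_of_kernel ENNReal.ofReal_ne_top (hker j).1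
    fun y => lintegral_kernel_le (zpow_pos hc0 j).le hε.le (hsize j y)
  obtain ⟨D, hD⟩ := exists_atom_bound hker hP (fun f => (hsum f).cauchySeq) hα hA hε hc hsize hdiff
  let Q (N : ℕ) : Lp ℂ 1 rho →L[ℂ] Lp ℂ 1 rho := ∑ j ∈ Finset.Icc (-(N : ℤ)) N, P j
  have hQ (N : ℕ) (f : Lp ℂ 1 rho) : Q N f = ∑ j ∈ Finset.Icc (-(N : ℤ)) N, P j f :=
    _root_.sum_apply ..
  have hlim (f : hardy) := exists_tendsto_of_atoms (Q := Q) (D := D)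
    (fun u hu N => by simpa only [hQ] using (hD u hu).1 N)
    (fun u hu => by simpa only [hQ] using (hD u hu).2) f.2
  choose S₀ hS₀ hS₀_le using hlim
  let S : hardy →ₗ[ℂ] Lp ℂ 1 rho := linearMapOfTendsto S₀
    (fun N => (Q N : Lp ℂ 1 rho →ₗ[ℂ] Lp ℂ 1 rho) ∘ₗ hardy.subtype) (tendsto_pi_nhds.2 hS₀)
  have hST (f : hardy) (g : Lp ℂ 2 rho) (hfg : (f : Lp ℂ 1 rho) =ᵐ[rho] g) : S f =ᵐ[rho] T g := by
    -- convergence in `L¹` and in `L²` both imply convergence in measure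
    refine tendstoInMeasure_ae_unique (tendstoInMeasure_of_tendsto_Lp (hS₀ f)) ?_
    refine (tendstoInMeasure_of_tendsto_Lp (hsum g)).congr_left fun N => ?_
    rw [hQ]
    exact (coeFn_L1_eq_L2 hker hP hfg _).symm
  refine ⟨S, ⟨⟨D, hS₀_le⟩, hST⟩, ?_⟩
  rintro S' ⟨⟨C', hC'⟩, hS'T⟩
  refine sub_eq_zero.1 (eq_zero_of_forall_atom (C := C' + D) (fun f => ?_) fun u hu => ?_)
  · rw [LinearMap.sub_apply, ENNReal.coe_add, add_mul]
    exact enorm_sub_le.trans (add_le_add (hC' f) (hS₀_le f))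
  · obtain ⟨v, -, -, huv, -⟩ := hu.exists_estimate hker hP hα hA hε hc hsize hdiff
    rw [LinearMap.sub_apply, sub_eq_zero]
    exact Lp.ext ((hS'T ⟨u, _⟩ v huv).trans (hST ⟨u, _⟩ v huv).symm)
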